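/- Notation. For a real $n\times n$ matrix $A$ let $\sigma_1(A)\ge\dots\ge\sigma_n(A)$ be its singular values and $\|A\|_2$ its spectral norm. For a symmetric $n\times n$ matrix $M$ let $\lambda_1(M),\dots,\lambda_n(M)$ be its eigenvalues with multiplicity, ordered so that $|\lambda_1(M)|\ge\dots\ge|\lambda_n(M)|$ (ties broken arbitrarily). For $X\in\mathbb R^{n\times l}$ let $\mathcal K_q(A,X)=[AX,(AA^T)AX,\dots,(AA^T)^qAX]$. Theorem (Eigenvalue alignment). For all constants $c,c_1,c'>0$ there is a constant $C>0$, depending only on $c,c_1,c'$, such that the following holds. Let $1\le l\le n$, let $A\in\mathbb R^{n\times n}$ be symmetric with $\operatorname{rank}(A)>l$, and put $\alpha=\max\bigl(\|A\|_2/n^{c/2},\,\sigma_{l+1}(A)\bigr)$. Suppose that $k\in\{1,\dots,l\}$ satisfies $\sigma_k(A)\ge 2\alpha$ and $\sigma_{k+1}(A)<2\alpha$. Then there exists $p$ with $$k\le p\le l,\qquad \sigma_p(A)\ge\tfrac32\alpha,\qquad \sigma_p(A)-\sigma_{p+1}(A)\ge\frac{\|A\|_2}{2n^{c/2+1}},$$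 and for every such $p$ and every integer $q\ge C\log n$ (so a depth $q=O(\log n)$ suffices) the following holds. Let $X\in\mathbb R^{n\times l}$ have independent $\mathcal N(0,1)$ entries and let $Q$ be a matrix whose columns form an orthonormal basis of the column span of $\mathcal K_q(A,X)$. Then with probability at least $1-n^{-c'}$ there is a permutation $S$ of $\{1,\dots,p\}$ such that for all $i\in\{1,\dots,p\}$ $$\bigl|\lambda_i(A)-\lambda_{S(i)}(QQ^TAQQ^T)\bigr|\le\frac{\|A\|_2}{n^{c_1}},$$ and each $\lambda_{S(i)}(QQ^TAQQ^T)$ is a Ritz value, i.e. an eigenvalue of $Q^TAQ$. -/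

import Mathlib

open MeasureTheory ProbabilityTheory
open scoped Matrix Matrix.Norms.L2Operator

/-- The `i`-th largest singular value `σ_i(A)` of a square matrix, counted from `i = 1`
(Mathlib's sequence of singular values is counted from `0`). -/
noncomputable def sigma {n : ℕ} (A : Matrix (Fin n) (Fin n) ℝ) (i : ℕ) : ℝ :=
  (Matrix.toEuclideanLin A).singularValues (i - 1)

/-- `lam` lists the eigenvalues `λ_1(M), …, λ_n(M)` of the symmetric matrix `M`, with multiplicity,
in order of decreasing magnitude: `M = U Λ Uᵀ` with `U` orthogonal, `Λ = diag(lam)` and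
`|λ_1| ≥ … ≥ |λ_n|`. -/
def IsEigenvalueList {n : ℕ} (M : Matrix (Fin n) (Fin n) ℝ) (lam : Fin n → ℝ) : Prop :=
  (∃ U ∈ Matrix.orthogonalGroup (Fin n) ℝ, M = U * Matrix.diagonal lam * Uᵀ) ∧
    ∀ i j : Fin n, i ≤ j → |lam j| ≤ |lam i|

/-- The block Krylov matrix `[A X, (A Aᵀ) A X, …, (A Aᵀ)^q A X]` of depth `q`. -/
def krylov {n l : ℕ} (q : ℕ) (A : Matrix (Fin n) (Fin n) ℝ) (X : Matrix (Fin n) (Fin l) ℝ) :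
    Matrix (Fin n) (Fin (q + 1) × Fin l) ℝ :=
  Matrix.of fun i jb => ((A * Aᵀ) ^ (jb.1 : ℕ) * A * X) i jb.2

/-- The columns of `Q` form an orthonormal basis of the column span of `K`. -/
def IsOrthonormalColumnBasis {n r : ℕ} {κ : Type*} [Fintype κ]
    (Q : Matrix (Fin n) (Fin r) ℝ) (K : Matrix (Fin n) κ ℝ) : Prop :=
  Qᵀ * Q = 1 ∧ LinearMap.range Q.mulVecLin = LinearMap.range K.mulVecLin

/-- The entries of the random matrix `X` are independent standard Gaussians. -/
def IsGaussianBlock {Ω : Type*} [MeasurableSpace Ω] (P : Measure Ω) {n l : ℕ}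
    (X : Ω → Matrix (Fin n) (Fin l) ℝ) : Prop :=
  (∀ i j, HasLaw (fun ω => X ω i j) (gaussianReal 0 1) P) ∧
    iIndepFun (fun (ij : Fin n × Fin l) (ω : Ω) => X ω ij.1 ij.2) P

/-- `α = max (‖A‖₂ / n^(c/2)) σ_{l+1}(A)`. -/
noncomputable def threshold {n : ℕ} (A : Matrix (Fin n) (Fin n) ℝ) (l : ℕ) (c : ℝ) : ℝ :=
  max (‖A‖ / (n : ℝ) ^ (c / 2)) (sigma A (l + 1))

/-- `k ∈ [l]` with `σ_k(A) ≥ 2α` and `σ_{k+1}(A) < 2α`. -/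
def IsThresholdIndex {n : ℕ} (A : Matrix (Fin n) (Fin n) ℝ) (l : ℕ) (c : ℝ) (k : ℕ) : Prop :=
  1 ≤ k ∧ k ≤ l ∧ 2 * threshold A l c ≤ sigma A k ∧ sigma A (k + 1) < 2 * threshold A l c

/-- `k ≤ p ≤ l` with `σ_p(A) ≥ (3/2) α` and `σ_p(A) - σ_{p+1}(A) ≥ ‖A‖₂ / (2 n^(c/2+1))`. -/
def IsGapIndex {n : ℕ} (A : Matrix (Fin n) (Fin n) ℝ) (l : ℕ) (c : ℝ) (k p : ℕ) : Prop :=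
  k ≤ p ∧ p ≤ l ∧ 3 / 2 * threshold A l c ≤ sigma A p ∧
    ‖A‖ / (2 * (n : ℝ) ^ (c / 2 + 1)) ≤ sigma A p - sigma A (p + 1)

/-- Every symmetric matrix has such a list of eigenvalues. -/
theorem exists_isEigenvalueList {n : ℕ} (M : Matrix (Fin n) (Fin n) ℝ) (hM : M.IsSymm) :
    ∃ lam, IsEigenvalueList M lam := by
  have hH : M.IsHermitian := by
    rw [Matrix.IsHermitian, Matrix.conjTranspose_eq_transpose_of_trivial]; exact hM
  let s : Equiv.Perm (Fin n) := Tuple.sort fun i => -|hH.eigenvalues i|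
  let V : Matrix (Fin n) (Fin n) ℝ := hH.eigenvectorUnitary
  have hV : V * Vᵀ = 1 := by
    simpa [Matrix.star_eq_conjTranspose] using Unitary.mul_star_self_of_mem hH.eigenvectorUnitary.2
  have hsp : M = V * Matrix.diagonal hH.eigenvalues * Vᵀ := by
    have h := hH.spectral_theorem
    simpa [Unitary.conjStarAlgAut_apply, Matrix.star_eq_conjTranspose, V, Function.comp_def] using h
  refine ⟨hH.eigenvalues ∘ s, ⟨V.submatrix id s, ?_, ?_⟩, ?_⟩
  · rw [Matrix.mem_orthogonalGroup_iff]
    change V.submatrix id s * Vᵀ.submatrix s id = 1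
    rw [Matrix.submatrix_mul_equiv, hV]; simp
  · have hd : Matrix.diagonal (hH.eigenvalues ∘ s)
        = (Matrix.diagonal hH.eigenvalues).submatrix s s := by simp
    rw [hd, Matrix.transpose_submatrix, Matrix.submatrix_mul_equiv, Matrix.submatrix_mul_equiv]
    simpa using hsp
  · intro i j hij
    have := Tuple.monotone_sort (fun i => -|hH.eigenvalues i|) hij
    simpa using this

/-- Every matrix has an orthonormal basis of its column span. -/
theorem exists_isOrthonormalColumnBasis {n : ℕ} {κ : Type*} [Fintype κ]
    (K : Matrix (Fin n) κ ℝ) :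
    ∃ (r : ℕ) (Q : Matrix (Fin n) (Fin r) ℝ), IsOrthonormalColumnBasis Q K := by
  let W : Submodule ℝ (EuclideanSpace ℝ (Fin n)) :=
    Submodule.span ℝ (Set.range fun j => WithLp.toLp 2 (K.col j))
  let b := stdOrthonormalBasis ℝ W
  refine ⟨_, Matrix.of fun i j => (b j : EuclideanSpace ℝ (Fin n)) i, ?_, ?_⟩
  · ext i j
    have h := orthonormal_iff_ite.mp b.orthonormal i j
    rw [Submodule.coe_inner] at h
    simp only [PiLp.inner_apply, RCLike.inner_apply, conj_trivial] at h
    simp only [Matrix.mul_apply, Matrix.transpose_apply, Matrix.of_apply, Matrix.one_apply]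
    rw [← h]
    exact Finset.sum_congr rfl fun _ _ => mul_comm _ _
  · have hspan : Submodule.span ℝ (Set.range fun j => (b j : EuclideanSpace ℝ (Fin n))) = W := by
      have h2 := congrArg (Submodule.map W.subtype) b.toBasis.span_eq
      rw [Submodule.map_span, Submodule.map_top, Submodule.range_subtype, ← Set.range_comp] at h2
      refine Eq.trans ?_ h2
      congr 2
    have h3 := congrArg
      (Submodule.map (WithLp.linearEquiv 2 ℝ (Fin n → ℝ)).toLinearMap) hspan
    rw [Submodule.map_span, Submodule.map_span, ← Set.range_comp, ← Set.range_comp] at h3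
    rw [Matrix.range_mulVecLin, Matrix.range_mulVecLin]
    exact h3

/-! Let `u i` be the eigenvectors of `A`, and let `W` hold the first `l` of them as columns. With
high probability the square matrix `Wᵀ * X` is polynomially well conditioned and `X` has
polynomially bounded entries. Solving `Wᵀ X y = e_i` then gives a vector `X y` of polynomial norm
whose first `l` eigencoordinates are those of `u i`. Since `σ_p ≥ (3/2) α` and `α ≥ σ_{l+1}`,
applying `A ^ (2q+1)` and rescaling shrinks the other coordinates by `(2/3)^(2q+1)`, so for `q ≳ log
n` each `u i`, `i < p`, is polynomially close to the Krylov space (`exists_mem_range_krylov_close`).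

Hence `u i` is an approximate eigenvector of the compression `QQᵀAQQᵀ`. A Hall-type argument
(`exists_injective_eigenvalue_matching`) matches the `p` leading eigenvalues injectively with nearby
eigenvalues of the compression. Compression does not increase ordered magnitudes
(`abs_eigenvalue_compression_le`), so past index `p` these are at most `σ_{p+1}`. The gap at `p`
therefore forces the matching into the first `p` indices, where it is a permutation. The matched
values are nonzero, hence Ritz values.

Conditioning is proved without rotation invariance: fixing all entries of `X` but one,
near-singularity confines that entry to a short interval, and the Gaussian density is at most 1
(`degenerateSet_slice`). -/

/-! ### Spectral comparison and matching in eigenbases. -/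

section EigenbasisEstimates

variable {E : Type*} [NormedAddCommGroup E] [InnerProductSpace ℝ E] {n : ℕ}

open scoped InnerProductSpace

theorem inner_map_eigenbasis (u : OrthonormalBasis (Fin n) ℝ E) {A : E →ₗ[ℝ] E} {lam : Fin n → ℝ}
    (hA : ∀ i, A (u i) = lam i • u i) (i : Fin n) (y : E) :
    ⟪u i, A y⟫_ℝ = lam i * ⟪u i, y⟫_ℝ := by
  conv_lhs => rw [← u.sum_repr' y]
  rw [map_sum, inner_sum, Finset.sum_eq_single i]
  · rw [map_smul, hA, inner_smul_right, inner_smul_right, real_inner_self_eq_norm_sq,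
      u.norm_eq_one]
    ring
  · intro j _ hj
    rw [map_smul, hA, inner_smul_right, inner_smul_right, u.inner_eq_zero hj.symm]
    simp
  · simp

theorem norm_sq_map_eigenbasis (u : OrthonormalBasis (Fin n) ℝ E) {A : E →ₗ[ℝ] E}
    {lam : Fin n → ℝ} (hA : ∀ i, A (u i) = lam i • u i) (y : E) :
    ‖A y‖ ^ 2 = ∑ i, lam i ^ 2 * ⟪u i, y⟫_ℝ ^ 2 := by
  rw [← u.sum_sq_inner_right (A y)]
  refine Finset.sum_congr rfl fun i _ => ?_
  rw [inner_map_eigenbasis u hA]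
  ring

/-- The ordered eigenvalue magnitudes of a compression `R A R` are dominated by those of `A`. -/
theorem abs_eigenvalue_compression_le (u v : OrthonormalBasis (Fin n) ℝ E)
    {A M R : E →ₗ[ℝ] E} {lam mu : Fin n → ℝ}
    (hA : ∀ i, A (u i) = lam i • u i) (hM : ∀ i, M (v i) = mu i • v i)
    (hR : ∀ x, ‖R x‖ ≤ ‖x‖) (hMA : ∀ x, M x = R (A (R x)))
    (hlam : ∀ i j : Fin n, i ≤ j → |lam j| ≤ |lam i|)
    (hmu : ∀ i j : Fin n, i ≤ j → |mu j| ≤ |mu i|) (j : Fin n) :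
    |mu j| ≤ |lam j| := by
  have : FiniteDimensional ℝ E := u.toBasis.finiteDimensional_of_finite
  -- Only `n - 1` linear conditions, so some `x ≠ 0` lies in the span of `v k`, `k ≤ j`, while `R x`
  -- lies in the span of `u k`, `k ≥ j`.
  let F : E →ₗ[ℝ] ({k : Fin n // k ≠ j} → ℝ) := LinearMap.pi fun k =>
    if j < k.1 then (innerSL ℝ (v k.1)).toLinearMap else (innerSL ℝ (u k.1)).toLinearMap ∘ₗ R
  have hdim : Module.finrank ℝ ({k : Fin n // k ≠ j} → ℝ) < Module.finrank ℝ E := by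
    rw [Module.finrank_eq_card_basis u.toBasis, Module.finrank_fintype_fun_eq_card]
    exact Fintype.card_subtype_lt (x := j) (by simp)
  obtain ⟨x, hx, hx0⟩ := Submodule.exists_mem_ne_zero_of_ne_bot
    (LinearMap.ker_ne_bot_of_finrank_lt hdim (f := F))
  have hv : ∀ k, j < k → ⟪v k, x⟫_ℝ = 0 := fun k hk => by
    have := congrFun hx ⟨k, hk.ne'⟩
    simpa [F, hk] using this
  have hu : ∀ k, k < j → ⟪u k, R x⟫_ℝ = 0 := fun k hk => by
    have := congrFun hx ⟨k, hk.ne⟩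
    simpa [F, hk.not_gt] using this
  have h1 : mu j ^ 2 * ‖x‖ ^ 2 ≤ ‖M x‖ ^ 2 := by
    rw [norm_sq_map_eigenbasis v hM, ← v.sum_sq_inner_right x, Finset.mul_sum]
    refine Finset.sum_le_sum fun k _ => ?_
    rcases lt_or_ge j k with hk | hk
    · simp [hv k hk]
    · exact mul_le_mul_of_nonneg_right (sq_le_sq.mpr (hmu k j hk)) (sq_nonneg _)
  have h2 : ‖A (R x)‖ ^ 2 ≤ lam j ^ 2 * ‖R x‖ ^ 2 := by
    rw [norm_sq_map_eigenbasis u hA, ← u.sum_sq_inner_right (R x), Finset.mul_sum]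
    refine Finset.sum_le_sum fun k _ => ?_
    rcases lt_or_ge k j with hk | hk
    · simp [hu k hk]
    · exact mul_le_mul_of_nonneg_right (sq_le_sq.mpr (hlam j k hk)) (sq_nonneg _)
  have h3 : ‖M x‖ ^ 2 ≤ ‖A (R x)‖ ^ 2 := by
    rw [hMA]
    exact pow_le_pow_left₀ (norm_nonneg _) (hR _) 2
  have h4 : lam j ^ 2 * ‖R x‖ ^ 2 ≤ lam j ^ 2 * ‖x‖ ^ 2 :=
    mul_le_mul_of_nonneg_left (pow_le_pow_left₀ (norm_nonneg _) (hR _) 2) (sq_nonneg _)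
  exact sq_le_sq.mp (le_of_mul_le_mul_right (h1.trans (h3.trans (h2.trans h4)))
    (pow_pos (norm_pos_iff.mpr hx0) 2))

/-- Approximate eigenvectors `u i`, `i < p`, can be matched injectively to nearby eigenvalues. -/
theorem exists_injective_eigenvalue_matching (u v : OrthonormalBasis (Fin n) ℝ E)
    {M : E →ₗ[ℝ] E} {lam mu : Fin n → ℝ} (hM : ∀ i, M (v i) = mu i • v i) {p : ℕ} (hpn : p ≤ n)
    {η ε : ℝ} (hη : (n : ℝ) ^ 2 * η < ε)
    (hu : ∀ i : Fin p, ‖M (u (i.castLE hpn)) - lam (i.castLE hpn) • u (i.castLE hpn)‖ ≤ η) :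
    ∃ f : Fin p → Fin n, Function.Injective f ∧ ∀ i, |lam (i.castLE hpn) - mu (f i)| ≤ ε := by
  classical
  have : FiniteDimensional ℝ E := u.toBasis.finiteDimensional_of_finite
  -- Hall's marriage theorem: it suffices that every `I` has at least `|I|` eigenvalues `mu j`
  -- within `ε`.
  refine (Fintype.all_card_le_filter_rel_iff_exists_injective
    (fun (i : Fin p) (j : Fin n) => |lam (i.castLE hpn) - mu j| ≤ ε)).mp fun I => ?_
  by_contra! hcard
  obtain ⟨J, hJ, hcard⟩ : ∃ J : Finset (Fin n),
      (∀ j, j ∈ J ↔ ∃ i ∈ I, |lam (i.castLE hpn) - mu j| ≤ ε) ∧ J.card < I.card :=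
    ⟨_, by simp, hcard⟩
  -- If `|J| < |I|`, some nonzero combination `x` of the `u i`, `i ∈ I`, is orthogonal to every `v
  -- j`, `j ∈ J`. Its components along the other `v j` are small because `mu j` is far from each
  -- `lam i`, contradicting Parseval.
  let F : (I → ℝ) →ₗ[ℝ] (J → ℝ) := LinearMap.pi fun j =>
    (innerSL ℝ (v j.1)).toLinearMap ∘ₗ
      Fintype.linearCombination ℝ (fun i : I => u (i.1.castLE hpn))
  have hdim : Module.finrank ℝ (J → ℝ) < Module.finrank ℝ (I → ℝ) := by
    simpa using hcard
  obtain ⟨a, ha, ha0⟩ := Submodule.exists_mem_ne_zero_of_ne_bot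
    (LinearMap.ker_ne_bot_of_finrank_lt hdim (f := F))
  obtain ⟨i₀, hi₀⟩ := Function.ne_iff.mp ha0
  have hn : (1 : ℝ) ≤ n := by
    have := (i₀.1.castLE hpn).pos
    exact_mod_cast this
  have hη0 : 0 ≤ η := (norm_nonneg _).trans (hu i₀.1)
  have hε : 0 < ε := lt_of_le_of_lt (by positivity) hη
  set x := Fintype.linearCombination ℝ (fun i : I => u (i.1.castLE hpn)) a with hxdef
  have hon : Orthonormal ℝ (fun i : I => u (i.1.castLE hpn)) :=
    u.orthonormal.comp _ fun i j hij => Subtype.ext (Fin.castLE_injective hpn hij)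
  have hux : ∀ i : I, ⟪u (i.1.castLE hpn), x⟫_ℝ = a i := fun i => by
    rw [hxdef, Fintype.linearCombination_apply]
    exact hon.inner_right_fintype a i
  have hx0 : 0 < ‖x‖ := norm_pos_iff.mpr fun h => hi₀ (by rw [← hux, h]; simp)
  have hax : ∀ i, |a i| ≤ ‖x‖ := fun i => by
    rw [← hux]
    simpa using abs_real_inner_le_norm (u (i.1.castLE hpn)) x
  have hsmall : ∀ j, |⟪v j, x⟫_ℝ| * ε ≤ n * (‖x‖ * η) := by
    intro j
    by_cases hj : j ∈ J
    · have : ⟪v j, x⟫_ℝ = 0 := by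
        have := congrFun ha ⟨j, hj⟩
        simpa [F, hxdef] using this
      rw [this]
      simp only [abs_zero, zero_mul]
      positivity
    · have hterm : ∀ i : I, |a i * ⟪v j, u (i.1.castLE hpn)⟫_ℝ| * ε ≤ ‖x‖ * η := by
        intro i
        have hgap : ε ≤ |mu j - lam (i.1.castLE hpn)| := by
          by_contra! h
          exact hj ((hJ j).mpr ⟨i.1, i.2, by rw [abs_sub_comm]; exact h.le⟩)
        have h1 : |mu j - lam (i.1.castLE hpn)| * |⟪v j, u (i.1.castLE hpn)⟫_ℝ| ≤ η := by
          rw [← abs_mul]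
          have : (mu j - lam (i.1.castLE hpn)) * ⟪v j, u (i.1.castLE hpn)⟫_ℝ
              = ⟪v j, M (u (i.1.castLE hpn)) - lam (i.1.castLE hpn) • u (i.1.castLE hpn)⟫_ℝ := by
            rw [inner_sub_right, inner_map_eigenbasis v hM, inner_smul_right]
            ring
          rw [this]
          refine (abs_real_inner_le_norm _ _).trans ?_
          simpa using hu i.1
        rw [abs_mul, mul_assoc]
        refine mul_le_mul (hax i) ?_ (by positivity) (norm_nonneg _)
        rw [mul_comm]
        exact (mul_le_mul_of_nonneg_right hgap (abs_nonneg _)).trans h1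
      have hexp : ⟪v j, x⟫_ℝ = ∑ i : I, a i * ⟪v j, u (i.1.castLE hpn)⟫_ℝ := by
        rw [hxdef, Fintype.linearCombination_apply, inner_sum]
        simp [inner_smul_right]
      rw [hexp]
      calc |∑ i : I, a i * ⟪v j, u (i.1.castLE hpn)⟫_ℝ| * ε
          ≤ (∑ i : I, |a i * ⟪v j, u (i.1.castLE hpn)⟫_ℝ|) * ε :=
            mul_le_mul_of_nonneg_right (Finset.abs_sum_le_sum_abs _ _) hε.le
        _ ≤ ∑ i : I, ‖x‖ * η := by
            rw [Finset.sum_mul]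
            exact Finset.sum_le_sum fun i _ => hterm i
        _ = (I.card : ℝ) * (‖x‖ * η) := by simp
        _ ≤ n * (‖x‖ * η) := by
            refine mul_le_mul_of_nonneg_right ?_ (by positivity)
            have := I.card_le_univ
            simp only [Fintype.card_fin] at this
            exact_mod_cast this.trans hpn
  have hsum : ‖x‖ ^ 2 * ε ^ 2 ≤ n * (n * (‖x‖ * η)) ^ 2 := by
    rw [← v.sum_sq_inner_right x, Finset.sum_mul]
    refine (Finset.sum_le_card_nsmul _ _ ((n * (‖x‖ * η)) ^ 2) fun j _ => ?_).trans (by simp)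
    rw [← mul_pow, ← sq_abs, abs_mul, abs_of_pos hε]
    exact pow_le_pow_left₀ (by positivity) (hsmall j) 2
  have h1 : ε ^ 2 ≤ n ^ 3 * η ^ 2 := by
    refine le_of_mul_le_mul_left ?_ (pow_pos hx0 2)
    calc _ ≤ _ := hsum
      _ = _ := by ring
  have h2 : ((n : ℝ) ^ 2 * η) ^ 2 < ε ^ 2 := pow_lt_pow_left₀ hη (by positivity) (by norm_num)
  have h3 : (n : ℝ) ^ 3 * η ^ 2 ≤ ((n : ℝ) ^ 2 * η) ^ 2 := by
    rw [mul_pow, ← pow_mul]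
    exact mul_le_mul_of_nonneg_right (pow_le_pow_right₀ hn (by norm_num)) (sq_nonneg _)
  linarith

end EigenbasisEstimates

/-! ### Eigenvalue lists, eigenbases and singular values. -/

section EigenvalueLists

variable {n : ℕ}

theorem IsEigenvalueList.exists_orthonormalBasis {M : Matrix (Fin n) (Fin n) ℝ} {lam : Fin n → ℝ}
    (h : IsEigenvalueList M lam) :
    ∃ u : OrthonormalBasis (Fin n) ℝ (EuclideanSpace ℝ (Fin n)),
      ∀ i, Matrix.toEuclideanLin M (u i) = lam i • u i := by
  obtain ⟨⟨U, hU, rfl⟩, -⟩ := h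
  have hUU : Uᵀ * U = 1 := (Matrix.mem_orthogonalGroup_iff' _ _).mp hU
  have hon : Orthonormal ℝ (fun i => (WithLp.toLp 2 (U.col i) : EuclideanSpace ℝ (Fin n))) := by
    rw [orthonormal_iff_ite]
    intro i j
    have := congrFun (congrFun hUU i) j
    rw [Matrix.mul_apply, Matrix.one_apply] at this
    simp only [PiLp.inner_apply, RCLike.inner_apply, conj_trivial, Matrix.col_apply]
    rw [← this]
    exact Finset.sum_congr rfl fun _ _ => mul_comm _ _
  refine ⟨OrthonormalBasis.mk hon
    (hon.linearIndependent.span_eq_top_of_card_eq_finrank' (by simp)).ge, fun i => ?_⟩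
  rw [OrthonormalBasis.coe_mk]
  apply (WithLp.linearEquiv 2 ℝ (Fin n → ℝ)).injective
  have hcol : U.col i = U *ᵥ Pi.single i 1 := by simp
  change (U * Matrix.diagonal lam * Uᵀ) *ᵥ U.col i = lam i • U.col i
  rw [hcol, Matrix.mulVec_mulVec, Matrix.mul_assoc _ Uᵀ, hUU, Matrix.mul_one,
    ← Matrix.mulVec_mulVec, Matrix.diagonal_mulVec_single, ← Matrix.mulVec_smul]
  congr 1
  ext k
  simp [Pi.single_apply]

/-- The singular values of a symmetric matrix are its eigenvalue magnitudes. -/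
theorem IsEigenvalueList.singularValues_eq {A : Matrix (Fin n) (Fin n) ℝ} {lam : Fin n → ℝ}
    (hA : A.IsSymm) (h : IsEigenvalueList A lam) (i : Fin n) :
    (Matrix.toEuclideanLin A).singularValues i = |lam i| := by
  obtain ⟨u, hu⟩ := h.exists_orthonormalBasis
  set T := Matrix.toEuclideanLin A with hT
  have hsymm : T.IsSymmetric := Matrix.isSymmetric_toEuclideanLin_iff.mpr (by
    rw [Matrix.IsHermitian, Matrix.conjTranspose_eq_transpose_of_trivial]; exact hA)
  have hadj : LinearMap.adjoint T = T := LinearMap.isSymmetric_iff_isSelfAdjoint T |>.mp hsymm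
  have hfin : Module.finrank ℝ (EuclideanSpace ℝ (Fin n)) = n := by simp
  have hTT := T.isSymmetric_adjoint_comp_self
  let v := hTT.eigenvectorBasis hfin
  have hv : ∀ i, (LinearMap.adjoint T ∘ₗ T) (v i) = (T.singularValues i ^ 2) • v i := fun i => by
    rw [T.sq_singularValues_fin hfin]
    exact hTT.apply_eigenvectorBasis hfin i
  have hu' : ∀ i, (LinearMap.adjoint T ∘ₗ T) (u i) = (lam i ^ 2) • u i := fun i => by
    rw [LinearMap.comp_apply, hadj, hu, map_smul, hu, smul_smul, sq]
  have ho : ∀ i j : Fin n, i ≤ j → |lam j ^ 2| ≤ |lam i ^ 2| := fun i j hij => by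
    rw [abs_pow, abs_pow]
    exact pow_le_pow_left₀ (abs_nonneg _) (h.2 i j hij) 2
  have ho' : ∀ i j : Fin n, i ≤ j → |T.singularValues j ^ 2| ≤ |T.singularValues i ^ 2| :=
    fun i j hij => by
      rw [abs_pow, abs_pow, abs_of_nonneg (T.singularValues_nonneg _),
        abs_of_nonneg (T.singularValues_nonneg _)]
      exact pow_le_pow_left₀ (T.singularValues_nonneg _) (T.singularValues_antitone hij) 2
  -- Both bases diagonalize `AᵀA`; the trivial compression, used in both directions, shows that the
  -- ordered spectrum does not depend on the basis.
  have h1 := abs_eigenvalue_compression_le (R := LinearMap.id) u v hu' hv (fun _ => le_rfl)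
    (fun _ => rfl) ho ho' i
  have h2 := abs_eigenvalue_compression_le (R := LinearMap.id) v u hv hu' (fun _ => le_rfl)
    (fun _ => rfl) ho' ho i
  have h3 := le_antisymm h1 h2
  rw [abs_pow, abs_pow, abs_of_nonneg (T.singularValues_nonneg _)] at h3
  exact (pow_left_inj₀ (T.singularValues_nonneg _) (abs_nonneg _) two_ne_zero).mp h3

end EigenvalueLists

/-! ### Anticoncentration and conditioning of a Gaussian block. -/

section GaussianBlock

theorem gaussianReal_zero_one_le_volume (s : Set ℝ) : gaussianReal 0 1 s ≤ volume s := by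
  rw [gaussianReal_apply 0 one_ne_zero]
  calc ∫⁻ x in s, gaussianPDF 0 1 x ≤ ∫⁻ _ in s, 1 := by
        refine lintegral_mono fun x => ?_
        rw [gaussianPDF, ← ENNReal.ofReal_one, gaussianPDFReal_def]
        refine ENNReal.ofReal_le_ofReal (mul_le_one₀ ?_ (Real.exp_nonneg _) ?_)
        · refine inv_le_one_of_one_le₀ (Real.one_le_sqrt.mpr ?_)
          have := Real.pi_gt_three
          simp only [NNReal.coe_one]
          linarith
        · rw [Real.exp_le_one_iff]
          simp only [NNReal.coe_one, sub_zero, mul_one]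
          have := sq_nonneg x
          linarith
    _ = volume s := by simp

/-- Bound for a product measure by the diameter of the slices in one coordinate direction. -/
theorem pi_measure_le_of_slice_diam {ι : Type*} [Fintype ι] [DecidableEq ι] (μ : ι → Measure ℝ)
    [∀ i, IsProbabilityMeasure (μ i)] (i : ι) (hμ : ∀ s, μ i s ≤ volume s) {S : Set (ι → ℝ)}
    (hS : MeasurableSet S) {d : ℝ}
    (h : ∀ x a b, Function.update x i a ∈ S → Function.update x i b ∈ S → |a - b| ≤ d) :
    Measure.pi μ S ≤ ENNReal.ofReal d := by
  -- Fubini in one coordinate: each slice has measure at most its length, hence at most its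
  -- diameter.
  have key := lintegral_le_of_lmarginal_le (μ := μ) {i} (f := S.indicator 1)
    (g := fun _ => ENNReal.ofReal d) (measurable_one.indicator hS) measurable_const ?_
  · simpa [lintegral_indicator hS] using key
  · intro x
    rw [lmarginal_singleton, lmarginal_singleton]
    have hsl : MeasurableSet ((Function.update x i) ⁻¹' S) := measurable_update x hS
    have : (fun a => S.indicator (1 : (ι → ℝ) → ENNReal) (Function.update x i a))
        = ((Function.update x i) ⁻¹' S).indicator 1 := rfl
    simp only [this, lintegral_indicator hsl, Pi.one_apply, lintegral_const, measure_univ, mul_one,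
      one_mul, Measure.restrict_apply_univ]
    refine (hμ _).trans ((Real.volume_le_diam _).trans (Metric.ediam_le fun a ha b hb => ?_))
    rw [edist_dist, Real.dist_eq]
    exact ENNReal.ofReal_le_ofReal (h x a b ha hb)

variable {n l : ℕ}

/-- Arrays `x` for which `Wᵀ x` nearly annihilates a vector with dominant coordinate `j`, while the
remaining columns of `Wᵀ x` have a common normal `θ` such that `W θ` has a large coordinate `i`. -/
def degenerateSet (W : Matrix (Fin n) (Fin l) ℝ) (s : ℝ) (i : Fin n) (j : Fin l) :
    Set (Fin n × Fin l → ℝ) :=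
  {x | ∃ z : Metric.closedBall (0 : (Fin l → ℝ) × (Fin l → ℝ)) 1, |z.1.1 j| = 1 ∧
    (∀ k, k ≠ j → ((W *ᵥ z.1.2) ᵥ* Matrix.of fun a b => x (a, b)) k = 0) ∧
    1 / (n : ℝ) ≤ |(W *ᵥ z.1.2) i| ∧
    ∀ a, |(Wᵀ *ᵥ ((Matrix.of fun a b => x (a, b)) *ᵥ z.1.1)) a| ≤ s}

/-- The witnesses range over a compact ball, and projecting a closed set along a compact factor
keeps it closed. This supplies the measurability needed for Fubini. -/
theorem isClosed_degenerateSet (W : Matrix (Fin n) (Fin l) ℝ) (s : ℝ) (i : Fin n) (j : Fin l) :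
    IsClosed (degenerateSet W s i j) := by
  have : CompactSpace (Metric.closedBall (0 : (Fin l → ℝ) × (Fin l → ℝ)) 1) :=
    isCompact_iff_compactSpace.mp (isCompact_closedBall _ _)
  let C : Set ((Fin n × Fin l → ℝ) × Metric.closedBall (0 : (Fin l → ℝ) × (Fin l → ℝ)) 1) :=
    {q | |q.2.1.1 j| = 1 ∧
      (∀ k, k ≠ j → ((W *ᵥ q.2.1.2) ᵥ* Matrix.of fun a b => q.1 (a, b)) k = 0) ∧
      1 / (n : ℝ) ≤ |(W *ᵥ q.2.1.2) i| ∧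
      ∀ a, |(Wᵀ *ᵥ ((Matrix.of fun a b => q.1 (a, b)) *ᵥ q.2.1.1)) a| ≤ s}
  have hC : IsClosed C := by
    simp only [C, Matrix.mulVec, Matrix.vecMul, dotProduct, Matrix.of_apply, Set.ofPred_and,
      Set.ofPred_forall]
    refine IsClosed.inter ?_ (IsClosed.inter ?_ (IsClosed.inter ?_ ?_))
    · exact isClosed_eq (by fun_prop) (by fun_prop)
    · exact isClosed_iInter fun k => isClosed_iInter fun _ =>
        isClosed_eq (by fun_prop) (by fun_prop)
    · exact isClosed_le (by fun_prop) (by fun_prop)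
    · exact isClosed_iInter fun k => isClosed_le (by fun_prop) (by fun_prop)
  have himg : degenerateSet W s i j = Prod.fst '' C := by
    ext x
    simp [degenerateSet, C]
  rw [himg]
  exact isClosedMap_fst_of_compactSpace _ hC

theorem abs_dotProduct_le_of_forall_abs_le {θ v : Fin l → ℝ} {s : ℝ}
    (hθ : ∀ a, |θ a| ≤ 1) (hv : ∀ a, |v a| ≤ s) : |θ ⬝ᵥ v| ≤ l * s := by
  calc |θ ⬝ᵥ v| ≤ ∑ a, |θ a * v a| := Finset.abs_sum_le_sum_abs _ _
    _ ≤ ∑ _a : Fin l, s := Finset.sum_le_sum fun a _ => by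
        rw [abs_mul]
        exact (mul_le_mul (hθ a) (hv a) (abs_nonneg _) zero_le_one).trans_eq (one_mul s)
    _ = l * s := by simp

/-- Put `w = W θ`. Pairing `θ` with `Wᵀ X y` leaves only `(w X)_j y_j`, so `|(w X)_j| ≤ l s`. This
quantity is affine in the entry `(i, j)` with slope `w i`, and `|w i| ≥ 1/n`. -/
theorem degenerateSet_slice (W : Matrix (Fin n) (Fin l) ℝ) {s : ℝ} (hs : 0 ≤ s) (hln : l ≤ n)
    (i : Fin n) (j : Fin l) (x : Fin n × Fin l → ℝ) (a b : ℝ)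
    (ha : Function.update x (i, j) a ∈ degenerateSet W s i j)
    (hb : Function.update x (i, j) b ∈ degenerateSet W s i j) :
    |a - b| ≤ 2 * (n : ℝ) ^ 2 * s := by
  obtain ⟨⟨⟨y, θ⟩, hz⟩, hy, hθ, hW, hsm⟩ := ha
  obtain ⟨⟨⟨y', θ'⟩, hz'⟩, hy', -, -, hsm'⟩ := hb
  have hn : (0 : ℝ) < n := by exact_mod_cast i.pos
  simp only at hy hθ hW hsm hy' hsm'
  have hθ1 : ∀ a, |θ a| ≤ 1 := fun a => by
    have h1 : ‖((y, θ) : (Fin l → ℝ) × (Fin l → ℝ))‖ ≤ 1 := by simpa using hz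
    exact (norm_le_pi_norm θ a).trans ((norm_snd_le (y, θ)).trans h1)
  set w := W *ᵥ θ with hw
  set Xa : Matrix (Fin n) (Fin l) ℝ := Matrix.of fun c d => Function.update x (i, j) a (c, d)
  set Xb : Matrix (Fin n) (Fin l) ℝ := Matrix.of fun c d => Function.update x (i, j) b (c, d)
  have hdual : ∀ (Y : Matrix (Fin n) (Fin l) ℝ) (v : Fin l → ℝ), |v j| = 1 →
      (∀ k, k ≠ j → (w ᵥ* Y) k = 0) → (∀ a, |(Wᵀ *ᵥ (Y *ᵥ v)) a| ≤ s) →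
      |(w ᵥ* Y) j| ≤ l * s := by
    intro Y v hv hk hsmall
    have h1 : θ ⬝ᵥ (Wᵀ *ᵥ (Y *ᵥ v)) = (w ᵥ* Y) j * v j := by
      rw [Matrix.dotProduct_mulVec, Matrix.vecMul_transpose, ← hw, Matrix.dotProduct_mulVec,
        dotProduct, Finset.sum_eq_single j]
      · intro k _ hkj
        rw [hk k hkj, zero_mul]
      · simp
    have h2 := abs_dotProduct_le_of_forall_abs_le hθ1 hsmall
    rwa [h1, abs_mul, hv, mul_one] at h2
  -- The normal `θ` found for `a` also serves for `b`: it depends only on the columns other than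
  -- `j`, which the update leaves alone.
  have hcol : ∀ k, k ≠ j → (w ᵥ* Xb) k = 0 := fun k hk => by
    rw [← hθ k hk]
    simp only [Matrix.vecMul, dotProduct, Xa, Xb, Matrix.of_apply]
    refine Finset.sum_congr rfl fun c _ => ?_
    rw [Function.update_of_ne (by simp [hk]), Function.update_of_ne (by simp [hk])]
  have h1 := hdual Xa y hy hθ hsm
  have h2 := hdual Xb y' hy' hcol hsm'
  have h3 : (w ᵥ* Xa) j - (w ᵥ* Xb) j = w i * (a - b) := by
    simp only [Matrix.vecMul, dotProduct, Xa, Xb, Matrix.of_apply]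
    rw [← Finset.sum_sub_distrib, Finset.sum_eq_single i]
    · simp [mul_sub]
    · intro c _ hc
      rw [Function.update_of_ne (by simp [hc]), Function.update_of_ne (by simp [hc]), sub_self]
    · simp
  have h4 : |w i| * |a - b| ≤ 2 * (l * s) := by
    rw [← abs_mul, ← h3]
    exact (abs_sub _ _).trans (by linarith)
  have h5 : 1 / (n : ℝ) * |a - b| ≤ 2 * (n * s) :=
    (mul_le_mul_of_nonneg_right hW (abs_nonneg _)).trans (h4.trans (by gcongr))
  rw [one_div, inv_mul_le_iff₀ hn] at h5
  exact h5.trans_eq (by ring)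

theorem exists_abs_eq_pi_norm {v : Fin l → ℝ} (hl : 1 ≤ l) : ∃ j, |v j| = ‖v‖ := by
  have : Nonempty (Fin l) := ⟨⟨0, hl⟩⟩
  obtain ⟨j, hj⟩ := Finite.exists_max fun i => |v i|
  exact ⟨j, le_antisymm (norm_le_pi_norm v j) ((pi_norm_le_iff_of_nonneg (abs_nonneg _)).mpr hj)⟩

/-- Outside the degenerate sets, `Wᵀ x` is bounded below. -/
theorem le_norm_mulVec_of_notMem_degenerateSet {W : Matrix (Fin n) (Fin l) ℝ} (hW : Wᵀ * W = 1)
    (hl : 1 ≤ l) {s : ℝ} {x : Fin n × Fin l → ℝ} (hx : ∀ i j, x ∉ degenerateSet W s i j)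
    (y : Fin l → ℝ) :
    s * ‖y‖ ≤ ‖Wᵀ *ᵥ ((Matrix.of fun a b => x (a, b)) *ᵥ y)‖ := by
  set X : Matrix (Fin n) (Fin l) ℝ := Matrix.of fun a b => x (a, b) with hX
  by_contra! hlt
  have hy0 : 0 < ‖y‖ := by
    refine norm_pos_iff.mpr fun h => ?_
    simp [h] at hlt
  obtain ⟨j, hj⟩ := exists_abs_eq_pi_norm (v := y) hl
  -- Orthogonality to the other `l - 1` columns of `Wᵀ X` always has a nonzero solution `θ`.
  let F : (Fin l → ℝ) →ₗ[ℝ] ({k : Fin l // k ≠ j} → ℝ) := LinearMap.pi fun k =>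
    LinearMap.proj k.1 ∘ₗ Matrix.vecMulLinear X ∘ₗ Matrix.mulVecLin W
  have hdim : Module.finrank ℝ ({k : Fin l // k ≠ j} → ℝ) < Module.finrank ℝ (Fin l → ℝ) := by
    rw [Module.finrank_fintype_fun_eq_card, Module.finrank_fintype_fun_eq_card]
    exact Fintype.card_subtype_lt (x := j) (by simp)
  obtain ⟨θ, hθ, hθ0⟩ := Submodule.exists_mem_ne_zero_of_ne_bot
    (LinearMap.ker_ne_bot_of_finrank_lt hdim (f := F))
  have hθ0' : 0 < ‖θ‖ := norm_pos_iff.mpr hθ0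
  have hker : ∀ k, k ≠ j → ((W *ᵥ θ) ᵥ* X) k = 0 := fun k hk => by
    have := congrFun hθ ⟨k, hk⟩
    simpa [F] using this
  obtain ⟨m, hm⟩ := exists_abs_eq_pi_norm (v := θ) hl
  have hiso : (W *ᵥ θ) ⬝ᵥ (W *ᵥ θ) = θ ⬝ᵥ θ := by
    rw [Matrix.dotProduct_mulVec, ← Matrix.mulVec_transpose, Matrix.mulVec_mulVec, hW,
      Matrix.one_mulVec]
  -- `W` preserves Euclidean length, which dominates the sup norm `‖θ‖`; hence not all coordinates
  -- of `W θ` can be below `‖θ‖ / n`.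
  obtain ⟨i, hi⟩ : ∃ i, 1 / (n : ℝ) * ‖θ‖ ≤ |(W *ᵥ θ) i| := by
    by_contra! hall
    have h1 : ‖θ‖ ^ 2 ≤ θ ⬝ᵥ θ := by
      rw [← hm, sq_abs, sq]
      exact Finset.single_le_sum (f := fun k => θ k * θ k) (fun k _ => mul_self_nonneg _)
        (Finset.mem_univ m)
    rcases Nat.eq_zero_or_pos n with hn | hn
    · subst hn
      have : (W *ᵥ θ) ⬝ᵥ (W *ᵥ θ) = 0 := by simp [dotProduct]
      have := pow_pos hθ0' 2
      linarith
    · have : Nonempty (Fin n) := ⟨⟨0, hn⟩⟩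
      have hn1 : (1 : ℝ) ≤ n := by exact_mod_cast hn
      have h2 : (W *ᵥ θ) ⬝ᵥ (W *ᵥ θ) < ∑ _i : Fin n, (1 / (n : ℝ) * ‖θ‖) ^ 2 :=
        Finset.sum_lt_sum_of_nonempty Finset.univ_nonempty fun k _ => by
          rw [← sq, ← sq_abs]
          exact pow_lt_pow_left₀ (hall k) (abs_nonneg _) two_ne_zero
      have h3 : ∑ _i : Fin n, (1 / (n : ℝ) * ‖θ‖) ^ 2 = 1 / n * ‖θ‖ ^ 2 := by
        simp only [Finset.sum_const, Finset.card_univ, Fintype.card_fin, nsmul_eq_mul]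
        field_simp
      have h4 : 1 / (n : ℝ) * ‖θ‖ ^ 2 ≤ 1 * ‖θ‖ ^ 2 :=
        mul_le_mul_of_nonneg_right ((div_le_one (by linarith)).mpr hn1) (sq_nonneg _)
      linarith
  refine hx i j ⟨⟨(‖y‖⁻¹ • y, ‖θ‖⁻¹ • θ), ?_⟩, ?_, ?_, ?_, ?_⟩
  · simp [Prod.norm_def, norm_smul, hy0.ne', hθ0'.ne']
  · simp [abs_mul, hj, hy0.ne']
  · intro k hk
    simp only [Matrix.mulVec_smul, Matrix.smul_vecMul, Pi.smul_apply, ← hX, hker k hk, smul_zero]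
  · simp only [Matrix.mulVec_smul, Pi.smul_apply, smul_eq_mul, abs_mul, abs_inv, abs_norm]
    rwa [le_inv_mul_iff₀ hθ0', mul_comm]
  · intro a
    simp only [Matrix.mulVec_smul, Pi.smul_apply, smul_eq_mul, abs_mul, abs_inv, abs_norm, ← hX]
    rw [inv_mul_le_iff₀ hy0, mul_comm]
    exact (norm_le_pi_norm _ a).trans hlt.le

theorem IsGaussianBlock.measure_degenerateSet_le {Ω : Type*} [MeasurableSpace Ω] {P : Measure Ω}
    [IsProbabilityMeasure P] {X : Ω → Matrix (Fin n) (Fin l) ℝ} (hX : IsGaussianBlock P X)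
    (hln : l ≤ n) (W : Matrix (Fin n) (Fin l) ℝ) {s : ℝ} (hs : 0 ≤ s) (i : Fin n) (j : Fin l) :
    P {ω | (fun ij : Fin n × Fin l => X ω ij.1 ij.2) ∈ degenerateSet W s i j}
      ≤ ENNReal.ofReal (2 * (n : ℝ) ^ 2 * s) := by
  have hmeas : ∀ ij : Fin n × Fin l, AEMeasurable (fun ω => X ω ij.1 ij.2) P :=
    fun ij => (hX.1 ij.1 ij.2).aemeasurable
  have hmap := (iIndepFun_iff_map_fun_eq_pi_map hmeas).mp hX.2
  simp only [(hX.1 _ _).map_eq] at hmap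
  have hset := (isClosed_degenerateSet W s i j).measurableSet
  have := pi_measure_le_of_slice_diam (fun _ : Fin n × Fin l => gaussianReal 0 1) (i, j)
    gaussianReal_zero_one_le_volume hset (degenerateSet_slice W hs hln i j)
  rwa [← hmap, Measure.map_apply_of_aemeasurable (aemeasurable_pi_lambda _ hmeas) hset] at this

/-- Chebyshev is enough, since `T` will be a power of `n`. -/
theorem IsGaussianBlock.measure_entry_gt_le {Ω : Type*} [MeasurableSpace Ω] {P : Measure Ω}
    {X : Ω → Matrix (Fin n) (Fin l) ℝ} (hX : IsGaussianBlock P X) {T : ℝ} (hT : 0 < T)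
    (i : Fin n) (j : Fin l) :
    P {ω | T ≤ |X ω i j|} ≤ ENNReal.ofReal (1 / T ^ 2) := by
  have h := meas_ge_le_variance_div_sq (memLp_id_gaussianReal (μ := 0) (v := 1) 2) hT
  rw [variance_id_gaussianReal] at h
  simp only [id, integral_id_gaussianReal, sub_zero, NNReal.coe_one] at h
  refine le_of_eq_of_le ?_ h
  exact (hX.1 i j).measure_eq (p := fun t => T ≤ |t|)
    (measurableSet_le measurable_const measurable_id.abs)

/-- With high probability a Gaussian block has bounded entries, and its projection onto the column
span of `W` is well conditioned. -/
theorem IsGaussianBlock.measure_not_wellConditioned_le {Ω : Type*} [MeasurableSpace Ω]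
    {P : Measure Ω} [IsProbabilityMeasure P] {X : Ω → Matrix (Fin n) (Fin l) ℝ}
    (hX : IsGaussianBlock P X) (hl : 1 ≤ l) (hln : l ≤ n) {W : Matrix (Fin n) (Fin l) ℝ}
    (hW : Wᵀ * W = 1) {s T : ℝ} (hs : 0 ≤ s) (hT : 0 < T) :
    P {ω | ¬ ((∀ y, s * ‖y‖ ≤ ‖Wᵀ *ᵥ (X ω *ᵥ y)‖) ∧ ∀ i j, |X ω i j| ≤ T)}
      ≤ ENNReal.ofReal ((n : ℝ) ^ 2 * (2 * (n : ℝ) ^ 2 * s + 1 / T ^ 2)) := by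
  have hsub : {ω | ¬ ((∀ y, s * ‖y‖ ≤ ‖Wᵀ *ᵥ (X ω *ᵥ y)‖) ∧ ∀ i j, |X ω i j| ≤ T)} ⊆
      ⋃ ij : Fin n × Fin l,
        ({ω | (fun ij : Fin n × Fin l => X ω ij.1 ij.2) ∈ degenerateSet W s ij.1 ij.2} ∪
          {ω | T ≤ |X ω ij.1 ij.2|}) := by
    intro ω hω
    by_contra hcon
    simp only [Set.mem_iUnion, Set.mem_union, Set.mem_ofPred_eq, not_exists, not_or, not_le,
      Prod.forall] at hcon
    have hx : ∀ i j, (fun ij : Fin n × Fin l => X ω ij.1 ij.2) ∉ degenerateSet W s i j :=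
      fun i j => (hcon i j).1
    rw [Set.mem_ofPred_eq] at hω
    refine hω ⟨fun y => ?_, fun i j => (hcon i j).2.le⟩
    have h := le_norm_mulVec_of_notMem_degenerateSet hW hl hx y
    exact h
  refine (measure_mono hsub).trans ((measure_iUnion_fintype_le _ _).trans ?_)
  have hb : ∀ ij : Fin n × Fin l,
      P ({ω | (fun ij : Fin n × Fin l => X ω ij.1 ij.2) ∈ degenerateSet W s ij.1 ij.2} ∪
          {ω | T ≤ |X ω ij.1 ij.2|}) ≤ ENNReal.ofReal (2 * (n : ℝ) ^ 2 * s + 1 / T ^ 2) := by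
    intro ij
    rw [ENNReal.ofReal_add (by positivity) (by positivity)]
    exact (measure_union_le _ _).trans (add_le_add (hX.measure_degenerateSet_le hln W hs _ _)
      (hX.measure_entry_gt_le hT _ _))
  refine (Finset.sum_le_sum fun ij _ => hb ij).trans ?_
  rw [Finset.sum_const, nsmul_eq_mul, ← ENNReal.ofReal_natCast, ← ENNReal.ofReal_mul (by positivity)]
  refine ENNReal.ofReal_le_ofReal (mul_le_mul_of_nonneg_right ?_ (by positivity))
  have : n * l ≤ n ^ 2 := by rw [sq]; exact Nat.mul_le_mul_left n hln
  simpa using (by exact_mod_cast this : (n * l : ℝ) ≤ n ^ 2)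

end GaussianBlock

/-! ### Compressions, Ritz values and power iteration. -/

section ApproximateInvariance

variable {n l : ℕ}

open scoped InnerProductSpace

local notation "toE" => Matrix.toEuclideanLin (𝕜 := ℝ)

theorem toEuclideanLin_isSymmetric {A : Matrix (Fin n) (Fin n) ℝ} (hA : A.IsSymm) :
    (toE A).IsSymmetric :=
  Matrix.isSymmetric_toEuclideanLin_iff.mpr (by
    rw [Matrix.IsHermitian, Matrix.conjTranspose_eq_transpose_of_trivial]; exact hA)

theorem norm_toEuclideanLin_le (A : Matrix (Fin n) (Fin n) ℝ) (x : EuclideanSpace ℝ (Fin n)) :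
    ‖toE A x‖ ≤ ‖A‖ * ‖x‖ :=
  A.l2_opNorm_mulVec x

theorem norm_sq_eq_add_of_projection {E : Type*} [NormedAddCommGroup E] [InnerProductSpace ℝ E]
    {R : E →ₗ[ℝ] E} (hR : R.IsSymmetric) (hRR : ∀ x, R (R x) = R x) (x : E) :
    ‖x‖ ^ 2 = ‖R x‖ ^ 2 + ‖x - R x‖ ^ 2 := by
  have h : ⟪R x, x - R x⟫_ℝ = 0 := by rw [hR, map_sub, hRR, sub_self, inner_zero_right]
  have := norm_add_sq_real (R x) (x - R x)
  rw [h, add_sub_cancel] at this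
  linarith

section Compression

variable {r : ℕ} {Q : Matrix (Fin n) (Fin r) ℝ}

theorem projection_apply_apply (hQ : Qᵀ * Q = 1) (x : EuclideanSpace ℝ (Fin n)) :
    toE (Q * Qᵀ) (toE (Q * Qᵀ) x) = toE (Q * Qᵀ) x := by
  rw [← LinearMap.comp_apply, ← Matrix.toLpLin_mul_same, Matrix.mul_assoc, ← Matrix.mul_assoc Qᵀ,
    hQ, Matrix.one_mul]

theorem projection_norm_sq (hQ : Qᵀ * Q = 1) (x : EuclideanSpace ℝ (Fin n)) :
    ‖x‖ ^ 2 = ‖toE (Q * Qᵀ) x‖ ^ 2 + ‖x - toE (Q * Qᵀ) x‖ ^ 2 :=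
  norm_sq_eq_add_of_projection (toEuclideanLin_isSymmetric (by simp [Matrix.IsSymm]))
    (projection_apply_apply hQ) x

theorem norm_projection_le (hQ : Qᵀ * Q = 1) (x : EuclideanSpace ℝ (Fin n)) :
    ‖toE (Q * Qᵀ) x‖ ≤ ‖x‖ := by
  refine (sq_le_sq₀ (norm_nonneg _) (norm_nonneg _)).mp ?_
  rw [projection_norm_sq hQ x]
  exact le_add_of_nonneg_right (sq_nonneg _)

/-- Pythagoras for `x - w`, as the projection fixes `w`. -/
theorem norm_sub_projection_le (hQ : Qᵀ * Q = 1) (x : EuclideanSpace ℝ (Fin n)) {w : Fin n → ℝ}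
    (hw : w ∈ LinearMap.range Q.mulVecLin) :
    ‖x - toE (Q * Qᵀ) x‖ ≤ ‖WithLp.toLp 2 w - x‖ := by
  obtain ⟨y, rfl⟩ := hw
  set z : EuclideanSpace ℝ (Fin n) := WithLp.toLp 2 (Q.mulVecLin y) with hz
  have hfix : toE (Q * Qᵀ) z = z := by
    rw [hz, Matrix.toLpLin_toLp, Matrix.toLin'_apply, Matrix.mulVecLin_apply, Matrix.mulVec_mulVec,
      Matrix.mul_assoc, hQ, Matrix.mul_one]
  have h := projection_norm_sq hQ (x - z)
  rw [map_sub, hfix, sub_sub_sub_cancel_right] at h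
  rw [norm_sub_rev _ x]
  exact (sq_le_sq₀ (norm_nonneg _) (norm_nonneg _)).mp (by nlinarith [sq_nonneg ‖toE (Q * Qᵀ) x - z‖])

theorem toEuclideanLin_compression (A : Matrix (Fin n) (Fin n) ℝ) (x : EuclideanSpace ℝ (Fin n)) :
    toE (Q * Qᵀ * A * Q * Qᵀ) x = toE (Q * Qᵀ) (toE A (toE (Q * Qᵀ) x)) := by
  rw [← LinearMap.comp_apply, ← LinearMap.comp_apply, ← Matrix.toLpLin_mul_same,
    ← Matrix.toLpLin_mul_same]
  simp only [Matrix.mul_assoc]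

/-- The nonzero eigenvalues of `Q Qᵀ A Q Qᵀ` are Ritz values. -/
theorem hasEigenvalue_ritz (hQ : Qᵀ * Q = 1) {A : Matrix (Fin n) (Fin n) ℝ}
    {v : EuclideanSpace ℝ (Fin n)} (hv : v ≠ 0) {m : ℝ} (hm : m ≠ 0)
    (h : toE (Q * Qᵀ * A * Q * Qᵀ) v = m • v) :
    Module.End.HasEigenvalue (Matrix.toLin' (Qᵀ * A * Q)) m := by
  have h' : (Q * Qᵀ * A * Q * Qᵀ) *ᵥ v.ofLp = m • v.ofLp :=
    congrArg (WithLp.ofLp) h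
  -- `Qᵀ v` is nonzero because `m v = Q Qᵀ A Q (Qᵀ v)` with `m ≠ 0`.
  refine Module.End.hasEigenvalue_of_hasEigenvector (x := Qᵀ *ᵥ v.ofLp)
    (Module.End.hasEigenvector_iff.mpr ⟨Module.End.mem_eigenspace_iff.mpr ?_, fun h0 => ?_⟩)
  · rw [Matrix.toLin'_apply, ← Matrix.mulVec_smul, ← h', Matrix.mulVec_mulVec, Matrix.mulVec_mulVec]
    congr 1
    rw [Matrix.mul_assoc Q Qᵀ A, Matrix.mul_assoc Q, Matrix.mul_assoc Q, ← Matrix.mul_assoc Qᵀ Q,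
      hQ, Matrix.one_mul]
  · rw [← Matrix.mulVec_mulVec, h0, Matrix.mulVec_zero] at h'
    rcases smul_eq_zero.mp h'.symm with h1 | h1
    · exact hm h1
    · exact hv (by ext k; exact congrFun h1 k)

/-- If the leading eigenvectors of `A` nearly lie in the column span of `Q`, and the leading
eigenvalues are separated from the others, then they are matched by leading Ritz values. -/
theorem exists_perm_ritz_values (hQ : Qᵀ * Q = 1) {A : Matrix (Fin n) (Fin n) ℝ}
    {lam mu : Fin n → ℝ} (hlam : ∀ i j : Fin n, i ≤ j → |lam j| ≤ |lam i|)
    (hmu : IsEigenvalueList (Q * Qᵀ * A * Q * Qᵀ) mu)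
    (u : OrthonormalBasis (Fin n) ℝ (EuclideanSpace ℝ (Fin n)))
    (hu : ∀ i, toE A (u i) = lam i • u i) {p : ℕ} (hpn : p ≤ n) {δ ε : ℝ}
    (hclose : ∀ i : Fin p, ∃ w ∈ LinearMap.range Q.mulVecLin,
      ‖WithLp.toLp 2 w - u (i.castLE hpn)‖ ≤ δ)
    (hδ : (n : ℝ) ^ 2 * (2 * ‖A‖ * δ) < ε)
    (hgap : ∀ i j : Fin n, (i : ℕ) < p → p ≤ j → ε < |lam i| - |lam j|)
    (hpos : ∀ i : Fin n, (i : ℕ) < p → ε < |lam i|) :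
    ∃ S : Equiv.Perm (Fin p), ∀ i : Fin p,
      |lam (Fin.castLE hpn i) - mu (Fin.castLE hpn (S i))| ≤ ε ∧
      Module.End.HasEigenvalue (Matrix.toLin' (Qᵀ * A * Q)) (mu (Fin.castLE hpn (S i))) := by
  obtain ⟨v, hv⟩ := hmu.exists_orthonormalBasis
  have hle := abs_eigenvalue_compression_le u v hu hv (norm_projection_le hQ)
    (toEuclideanLin_compression A) hlam hmu.2
  have hlamA : ∀ i, |lam i| ≤ ‖A‖ := fun i => by
    have := norm_toEuclideanLin_le A (u i)
    simpa [hu, norm_smul] using this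
  have happrox : ∀ i : Fin p, ‖toE (Q * Qᵀ * A * Q * Qᵀ) (u (i.castLE hpn))
      - lam (i.castLE hpn) • u (i.castLE hpn)‖ ≤ 2 * ‖A‖ * δ := by
    intro i
    obtain ⟨w, hw, hwδ⟩ := hclose i
    set x := u (i.castLE hpn)
    set R := toE (Q * Qᵀ)
    have hx : ‖R x - x‖ ≤ δ := by
      rw [norm_sub_rev]
      exact (norm_sub_projection_le hQ x hw).trans hwδ
    have hsplit : R (toE A (R x)) - lam (i.castLE hpn) • x
        = R (toE A (R x - x)) + lam (i.castLE hpn) • (R x - x) := by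
      rw [map_sub, map_sub, hu, map_smul, smul_sub]
      abel
    rw [toEuclideanLin_compression, hsplit]
    refine (norm_add_le _ _).trans ?_
    have h1 : ‖R (toE A (R x - x))‖ ≤ ‖A‖ * δ :=
      (norm_projection_le hQ _).trans ((norm_toEuclideanLin_le A _).trans
        (mul_le_mul_of_nonneg_left hx (norm_nonneg _)))
    have h2 : ‖lam (i.castLE hpn) • (R x - x)‖ ≤ ‖A‖ * δ := by
      rw [norm_smul]
      exact mul_le_mul (hlamA _) hx (norm_nonneg _) (norm_nonneg _)
    linarith
  obtain ⟨f, hf, hfε⟩ := exists_injective_eigenvalue_matching u v hv hpn hδ happrox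
  -- An index `f i ≥ p` would give `|lam i| ≤ |lam (f i)| + ε`, against the gap.
  have hfp : ∀ i, (f i : ℕ) < p := fun i => by
    by_contra! hge
    have h1 := hgap (i.castLE hpn) (f i) i.2 hge
    have h2 := hle (f i)
    have h3 := abs_sub_abs_le_abs_sub (lam (i.castLE hpn)) (mu (f i))
    have h4 := hfε i
    linarith
  let g : Fin p → Fin p := fun i => ⟨f i, hfp i⟩
  have hg : Function.Injective g := fun i j hij => hf (Fin.ext (Fin.mk.inj_iff.mp hij))
  refine ⟨Equiv.ofBijective g (Finite.injective_iff_bijective.mp hg), fun i => ?_⟩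
  have hgi : Fin.castLE hpn (Equiv.ofBijective g (Finite.injective_iff_bijective.mp hg) i) = f i :=
    Fin.ext rfl
  rw [hgi]
  refine ⟨hfε i, hasEigenvalue_ritz hQ (v.orthonormal.ne_zero (f i)) (fun h0 => ?_) (hv (f i))⟩
  have h1 := hfε i
  rw [h0, sub_zero] at h1
  exact absurd (hpos (i.castLE hpn) i.2) h1.not_gt

end Compression

section PowerIteration

theorem inner_pow_apply_eigenbasis {E : Type*} [NormedAddCommGroup E] [InnerProductSpace ℝ E]
    (u : OrthonormalBasis (Fin n) ℝ E) {T : E →ₗ[ℝ] E} {lam : Fin n → ℝ}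
    (hT : ∀ i, T (u i) = lam i • u i) (m : ℕ) (i : Fin n) (x : E) :
    ⟪u i, (T ^ m) x⟫_ℝ = lam i ^ m * ⟪u i, x⟫_ℝ := by
  induction m with
  | zero => simp
  | succ m ih => rw [pow_succ', Module.End.mul_apply, inner_map_eigenbasis u hT, ih]; ring

/-- Power iteration started from a vector whose leading coordinates are those of `u i`. -/
theorem norm_power_iterate_sub_le {E : Type*} [NormedAddCommGroup E] [InnerProductSpace ℝ E]
    (u : OrthonormalBasis (Fin n) ℝ E) {T : E →ₗ[ℝ] E} {lam : Fin n → ℝ}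
    (hT : ∀ i, T (u i) = lam i • u i) (m : ℕ) {i : Fin n} (hi : lam i ≠ 0) {ρ : ℝ} (hρ : 0 ≤ ρ)
    (htail : ∀ k : Fin n, l ≤ k → |lam k| ≤ ρ * |lam i|) {x : E}
    (hx : ∀ k : Fin n, (k : ℕ) < l → ⟪u k, x⟫_ℝ = if k = i then 1 else 0) (hil : (i : ℕ) < l) :
    ‖(lam i ^ m)⁻¹ • (T ^ m) x - u i‖ ≤ ρ ^ m * ‖x‖ := by
  refine (sq_le_sq₀ (norm_nonneg _) (by positivity)).mp ?_
  rw [← u.sum_sq_inner_right, mul_pow, ← u.sum_sq_inner_right x, Finset.mul_sum]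
  refine Finset.sum_le_sum fun k _ => ?_
  rw [inner_sub_right, inner_smul_right, inner_pow_apply_eigenbasis u hT,
    orthonormal_iff_ite.mp u.orthonormal]
  rcases lt_or_ge (k : ℕ) l with hk | hk
  · rw [hx k hk]
    by_cases hki : k = i
    · subst hki
      have : (lam k ^ m)⁻¹ * (lam k ^ m * 1) - 1 = 0 := by
        rw [mul_one, inv_mul_cancel₀ (pow_ne_zero _ hi), sub_self]
      rw [if_pos rfl, this, zero_pow two_ne_zero]
      positivity
    · simp [hki]
  · have hki : k ≠ i := fun h => by subst h; omega
    rw [if_neg hki, sub_zero, ← mul_assoc, mul_pow]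
    refine mul_le_mul_of_nonneg_right (sq_le_sq.mpr ?_) (sq_nonneg _)
    rw [abs_mul, abs_inv, abs_pow, abs_pow, abs_of_nonneg (pow_nonneg hρ m),
      inv_mul_le_iff₀ (pow_pos (abs_pos.mpr hi) m), mul_comm, ← mul_pow]
    exact pow_le_pow_left₀ (abs_nonneg _) (htail k hk) m

/-- By symmetry the last Krylov block is `A ^ (2q+1) X`; no other block is needed. -/
theorem mulVec_mem_range_krylov (q : ℕ) {A : Matrix (Fin n) (Fin n) ℝ} (hA : A.IsSymm)
    (X : Matrix (Fin n) (Fin l) ℝ) (y : Fin l → ℝ) :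
    A ^ (2 * q + 1) *ᵥ (X *ᵥ y) ∈ LinearMap.range (krylov q A X).mulVecLin := by
  refine ⟨fun jb => if jb.1 = Fin.last q then y jb.2 else 0, ?_⟩
  have hpow : A ^ (2 * q + 1) = (A * Aᵀ) ^ q * A := by
    rw [hA.eq, pow_succ, pow_mul, sq]
  rw [hpow, Matrix.mulVec_mulVec]
  ext i
  simp only [Matrix.mulVecLin_apply, Matrix.mulVec, dotProduct, krylov, Matrix.of_apply,
    Fintype.sum_prod_type]
  rw [Finset.sum_eq_single (Fin.last q)]
  · simp
  · intro b _ hb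
    simp [hb]
  · simp

/-- Every leading eigenvector is close to the Krylov space of a well conditioned starting block. -/
theorem exists_mem_range_krylov_close {A : Matrix (Fin n) (Fin n) ℝ} (hA : A.IsSymm)
    (u : OrthonormalBasis (Fin n) ℝ (EuclideanSpace ℝ (Fin n))) {lam : Fin n → ℝ}
    (hu : ∀ i, toE A (u i) = lam i • u i) (hln : l ≤ n) {X : Matrix (Fin n) (Fin l) ℝ}
    {W : Matrix (Fin n) (Fin l) ℝ} (hW : W = Matrix.of fun a k => u (k.castLE hln) a)
    {s T : ℝ} (hs : 0 < s) (hwell : ∀ y, s * ‖y‖ ≤ ‖Wᵀ *ᵥ (X *ᵥ y)‖)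
    (hT : ∀ i j, |X i j| ≤ T) (q : ℕ) (i : Fin l) (hi : lam (i.castLE hln) ≠ 0)
    {ρ : ℝ} (hρ : 0 ≤ ρ) (htail : ∀ k : Fin n, l ≤ k → |lam k| ≤ ρ * |lam (i.castLE hln)|) :
    ∃ w ∈ LinearMap.range (krylov q A X).mulVecLin,
      ‖WithLp.toLp 2 w - u (i.castLE hln)‖ ≤ ρ ^ (2 * q + 1) * ((n : ℝ) ^ 2 * (T / s)) := by
  have hinj : Function.Injective (Wᵀ * X).mulVecLin := by
    rw [injective_iff_map_eq_zero]
    intro y hy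
    have h := hwell y
    rw [Matrix.mulVec_mulVec, ← Matrix.mulVecLin_apply, hy, norm_zero] at h
    exact norm_le_zero_iff.mp (nonpos_of_mul_nonpos_right h hs)
  -- `Wᵀ X` is square, so the lower bound `s` gives both solvability and `‖y‖ ≤ 1/s`.
  obtain ⟨y, hy⟩ := LinearMap.injective_iff_surjective.mp hinj (Pi.single i 1)
  rw [Matrix.mulVecLin_apply, ← Matrix.mulVec_mulVec] at hy
  have hys : ‖y‖ ≤ 1 / s := by
    have h := hwell y
    rw [hy, Pi.norm_single, norm_one] at h
    rwa [le_div_iff₀ hs, mul_comm]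
  have hT0 : 0 ≤ T := (abs_nonneg _).trans (hT (i.castLE hln) i)
  have hn : (1 : ℝ) ≤ n := by exact_mod_cast (i.castLE hln).pos
  set x : EuclideanSpace ℝ (Fin n) := WithLp.toLp 2 (X *ᵥ y) with hxdef
  have hentry : ∀ a, |x a| ≤ n * (T / s) := by
    intro a
    calc |x a| = |∑ b, X a b * y b| := rfl
      _ ≤ ∑ b, |X a b * y b| := Finset.abs_sum_le_sum_abs _ _
      _ ≤ ∑ _b : Fin l, T * (1 / s) := Finset.sum_le_sum fun b _ => by
          rw [abs_mul]
          exact mul_le_mul (hT a b) ((norm_le_pi_norm y b).trans hys) (abs_nonneg _) hT0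
      _ = l * (T / s) := by simp [div_eq_mul_inv]
      _ ≤ n * (T / s) := by gcongr
  have hxn : ‖x‖ ≤ (n : ℝ) ^ 2 * (T / s) := by
    refine (sq_le_sq₀ (norm_nonneg _) (by positivity)).mp ?_
    rw [EuclideanSpace.norm_sq_eq]
    calc ∑ a, ‖x a‖ ^ 2 ≤ ∑ _a : Fin n, (n * (T / s)) ^ 2 := Finset.sum_le_sum fun a _ =>
          pow_le_pow_left₀ (norm_nonneg _) (hentry a) 2
      _ = n ^ 3 * (T / s) ^ 2 := by simp; ring
      _ ≤ n ^ 4 * (T / s) ^ 2 :=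
          mul_le_mul_of_nonneg_right (pow_le_pow_right₀ hn (by norm_num)) (sq_nonneg _)
      _ = _ := by ring
  have hx : ∀ k : Fin n, (k : ℕ) < l → ⟪u k, x⟫_ℝ = if k = i.castLE hln then 1 else 0 := by
    intro k hk
    have h := congrFun hy ⟨k, hk⟩
    have h1 : (Wᵀ *ᵥ (X *ᵥ y)) ⟨k, hk⟩ = ⟪u k, x⟫_ℝ := by
      simp only [hW, PiLp.inner_apply, RCLike.inner_apply, conj_trivial, hxdef]
      rw [Matrix.mulVec, dotProduct]
      exact Finset.sum_congr rfl fun a _ => mul_comm _ _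
    rw [← h1, h, Pi.single_apply]
    simp [Fin.ext_iff]
  refine ⟨(lam (i.castLE hln) ^ (2 * q + 1))⁻¹ • (A ^ (2 * q + 1) *ᵥ (X *ᵥ y)),
    Submodule.smul_mem _ _ (mulVec_mem_range_krylov q hA X y), ?_⟩
  have hpow : WithLp.toLp 2 (A ^ (2 * q + 1) *ᵥ (X *ᵥ y)) = (toE A ^ (2 * q + 1)) x := by
    rw [← Matrix.toLpLin_pow]
    rfl
  rw [WithLp.toLp_smul, hpow]
  exact (norm_power_iterate_sub_le u hu _ hi hρ htail hx i.2).trans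
    (mul_le_mul_of_nonneg_left hxn (by positivity))

end PowerIteration

end ApproximateInvariance

/-! ### Existence of a gap index and the depth estimate. -/

section Thresholds

variable {n : ℕ}

theorem sigma_succ_eq_abs {A : Matrix (Fin n) (Fin n) ℝ} (hA : A.IsSymm) {lam : Fin n → ℝ}
    (hlam : IsEigenvalueList A lam) (i : Fin n) : sigma A (i + 1) = |lam i| :=
  hlam.singularValues_eq hA i

theorem sigma_succ_pos {A : Matrix (Fin n) (Fin n) ℝ} {l : ℕ} (hrank : l < A.rank) :
    0 < sigma A (l + 1) := by
  refine (LinearMap.singularValues_pos_iff_lt_finrank_range _).mpr ?_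
  rwa [Matrix.rank_eq_finrank_range_toLin A (PiLp.basisFun 2 ℝ (Fin n))
    (PiLp.basisFun 2 ℝ (Fin n)), ← Matrix.toLpLin_eq_toLin] at hrank

/-- A drop from `2 α` to at most `α` forces a gap while the sequence is still above `3/2 α`. -/
theorem exists_isGapIndex {A : Matrix (Fin n) (Fin n) ℝ} {l : ℕ} (hln : l ≤ n)
    (hn : 0 < n) {c : ℝ} (hα : 0 < threshold A l c) {k : ℕ} (hk : IsThresholdIndex A l c k) :
    ∃ p : ℕ, IsGapIndex A l c k p := by
  obtain ⟨hk1, hkl, hk2, -⟩ := hk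
  set α := threshold A l c with hαdef
  have hn0 : (0 : ℝ) < n := by exact_mod_cast hn
  -- Without a gap each step drops by less than `α / (2n)`. At most `n` steps lead from `k` to `l +
  -- 1`, losing at most `α / 2`, so `σ_{l+1} ≥ (3/2) α > α`, which is absurd.
  have hgap : ‖A‖ / (2 * (n : ℝ) ^ (c / 2 + 1)) ≤ α / (2 * n) := by
    have h : ‖A‖ / (n : ℝ) ^ (c / 2) ≤ α := le_max_left _ _
    rw [Real.rpow_add hn0, Real.rpow_one]
    calc ‖A‖ / (2 * ((n : ℝ) ^ (c / 2) * n)) = ‖A‖ / (n : ℝ) ^ (c / 2) / (2 * n) := by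
          rw [div_div]; ring_nf
      _ ≤ α / (2 * n) := by gcongr
  by_contra! hno
  have hind : ∀ m, k + m ≤ l + 1 → 2 * α - m * (α / (2 * n)) ≤ sigma A (k + m) := by
    intro m
    induction m with
    | zero => intro _; simpa using hk2
    | succ m ih =>
      intro hm
      have h1 := ih (by omega)
      have hmn : (m : ℝ) ≤ n := by exact_mod_cast (by omega : m ≤ n)
      have h2 : 3 / 2 * α ≤ sigma A (k + m) := by
        have : (m : ℝ) * (α / (2 * n)) ≤ α / 2 := by
          calc (m : ℝ) * (α / (2 * n)) ≤ n * (α / (2 * n)) := by gcongr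
            _ = α / 2 := by field_simp
        linarith
      have h3 : ¬ _ := fun h => hno (k + m) ⟨by omega, by omega, h2, h⟩
      rw [not_le] at h3
      push_cast
      rw [← add_assoc]
      linarith
  have h := hind (l + 1 - k) (by omega)
  rw [Nat.add_sub_cancel' (by omega)] at h
  have h1 : sigma A (l + 1) ≤ α := le_max_right _ _
  have h2 : ((l + 1 - k : ℕ) : ℝ) * (α / (2 * n)) ≤ α / 2 := by
    have hmn : ((l + 1 - k : ℕ) : ℝ) ≤ n := by exact_mod_cast (by omega : l + 1 - k ≤ n)
    calc ((l + 1 - k : ℕ) : ℝ) * (α / (2 * n)) ≤ n * (α / (2 * n)) := by gcongr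
      _ = α / 2 := by field_simp
  linarith

/-- Each unit of depth gains `4/9 ≤ 1 - 1/2 ≤ exp (-1/2)`, so `2 d log N` units gain `N ^ (-d)`. -/
theorem two_thirds_pow_le_rpow {N : ℝ} (hN : 0 < N) {q : ℕ} {d : ℝ}
    (hq : 2 * d * Real.log N ≤ q) : (2 / 3 : ℝ) ^ (2 * q + 1) ≤ 2 / 3 * N ^ (-d) := by
  have h1 : (4 / 9 : ℝ) ≤ Real.exp (-(1 / 2)) := by
    have := Real.one_sub_le_exp_neg (1 / 2)
    linarith
  calc (2 / 3 : ℝ) ^ (2 * q + 1) = 2 / 3 * (4 / 9) ^ q := by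
        rw [pow_succ, pow_mul]; norm_num; ring
    _ ≤ 2 / 3 * Real.exp (-(1 / 2)) ^ q := by gcongr
    _ ≤ 2 / 3 * N ^ (-d) := by
        rw [← Real.exp_nat_mul, Real.rpow_def_of_pos hN]
        exact mul_le_mul_of_nonneg_left (Real.exp_le_exp.mpr (by linarith)) (by norm_num)

end Thresholds

/-! ### Assembly and choice of exponents. -/

theorem mainTheorem8 (c c₁ c' : ℝ) (hc : 0 < c) (hc₁ : 0 < c₁) (hc' : 0 < c') :
    ∃ C : ℝ, 0 < C ∧
      ∀ (n l : ℕ) (hl1 : 1 ≤ l) (hln : l ≤ n) (A : Matrix (Fin n) (Fin n) ℝ) (hA : A.IsSymm)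
        (hrank : l < A.rank) (k : ℕ) (hk : IsThresholdIndex A l c k),
        (∃ p : ℕ, IsGapIndex A l c k p) ∧
        ∀ (p : ℕ) (hp : IsGapIndex A l c k p) (hpn : p ≤ n)
          (q : ℕ) (hq : C * Real.log n ≤ q)
          {Ω : Type*} [MeasurableSpace Ω] (P : Measure Ω) [IsProbabilityMeasure P]
          (X : Ω → Matrix (Fin n) (Fin l) ℝ) (hX : IsGaussianBlock P X)
          (lam : Fin n → ℝ) (hlam : IsEigenvalueList A lam),
          P {ω | ¬ ∀ (r : ℕ) (Q : Matrix (Fin n) (Fin r) ℝ) (mu : Fin n → ℝ),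
              IsOrthonormalColumnBasis Q (krylov q A (X ω)) →
              IsEigenvalueList (Q * Qᵀ * A * Q * Qᵀ) mu →
              ∃ S : Equiv.Perm (Fin p), ∀ i : Fin p,
                |lam (Fin.castLE hpn i) - mu (Fin.castLE hpn (S i))| ≤ ‖A‖ / (n : ℝ) ^ c₁ ∧
                Module.End.HasEigenvalue (Matrix.toLin' (Qᵀ * A * Q))
                  (mu (Fin.castLE hpn (S i)))}
            ≤ ENNReal.ofReal (1 / (n : ℝ) ^ c') := by
  -- The tolerance `‖A‖ n^(-e)` must lie below both the target accuracy and the gap. In `d`, the two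
  -- middle terms pay for `T / s`; the `5` pays for two factors `n²` and one `n` absorbing a
  -- constant 2.
  set e : ℝ := c₁ + c / 2 + 3 with he
  set d : ℝ := 5 + (c' + 6) + (c' + 3) + e with hd
  refine ⟨2 * d, by positivity, fun n l hl1 hln A hA hrank k hk => ?_⟩
  have hln' : l < n := hrank.trans_le (by simpa using A.rank_le_card_width)
  have hn2 : (2 : ℝ) ≤ n := by exact_mod_cast (by omega : 2 ≤ n)
  have hn0 : (0 : ℝ) < n := by linarith
  have hn1 : (1 : ℝ) ≤ n := by linarith
  have hσ := sigma_succ_pos hrank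
  have hα : 0 < threshold A l c := hσ.trans_le (le_max_right _ _)
  refine ⟨exists_isGapIndex hln (by omega) hα hk, ?_⟩
  intro p hp hpn q hq Ω _ P _ X hX lam hlam
  obtain ⟨hkp, hpl, hpα, hpgap⟩ := hp
  have hp1 : 1 ≤ p := hk.1.trans hkp
  have hAnorm : 0 < ‖A‖ := by
    refine norm_pos_iff.mpr fun h => ?_
    subst h
    simp at hrank
  obtain ⟨u, hu⟩ := hlam.exists_orthonormalBasis
  -- `sigma` counts from 1 and `lam` from 0, so `σ_p` is `|lam (p-1)|`.
  have hσp : ∀ i : Fin n, (i : ℕ) < p → sigma A p ≤ |lam i| := fun i hi => by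
    have h := sigma_succ_eq_abs hA hlam ⟨p - 1, by omega⟩
    simp only [Nat.sub_add_cancel hp1] at h
    rw [h]
    exact hlam.2 _ _ (Fin.mk_le_mk.mpr (by omega))
  have hσtail : ∀ (m : ℕ) (j : Fin n), m ≤ j → |lam j| ≤ sigma A (m + 1) := fun m j hj => by
    rw [sigma_succ_eq_abs hA hlam ⟨m, hj.trans_lt j.2⟩]
    exact hlam.2 _ _ hj
  set N : ℝ := (n : ℝ) with hN
  have hpow2 : (2 : ℝ) ≤ N ^ (1 : ℝ) := by simpa using hn2
  set ε : ℝ := ‖A‖ * N ^ (-e) with hε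
  have hε0 : 0 < ε := by positivity
  have hεc₁ : ε ≤ ‖A‖ / N ^ c₁ := by
    rw [div_eq_mul_inv, ← Real.rpow_neg hn0.le]
    exact mul_le_mul_of_nonneg_left (Real.rpow_le_rpow_of_exponent_le hn1 (by linarith))
      hAnorm.le
  have hεgap : ε < ‖A‖ / (2 * N ^ (c / 2 + 1)) := by
    rw [hε, div_eq_mul_inv]
    refine mul_lt_mul_of_pos_left ?_ hAnorm
    rw [Real.rpow_neg hn0.le]
    refine inv_strictAnti₀ (by positivity) ?_
    calc 2 * N ^ (c / 2 + 1) ≤ N ^ (1 : ℝ) * N ^ (c / 2 + 1) := by gcongr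
      _ = N ^ (c / 2 + 2) := by rw [← Real.rpow_add hn0]; ring_nf
      _ < N ^ e := Real.rpow_lt_rpow_of_exponent_lt (by linarith) (by linarith)
  have hεpos : ε < sigma A p := by
    refine hεgap.trans_le (hpgap.trans (sub_le_self _ ?_))
    exact LinearMap.singularValues_nonneg _ _
  -- The exponents make each of the two failure terms, after the union bound over at most `n²`
  -- entries, at most `n^(-(c'+1))`.
  set s : ℝ := N ^ (-(c' + 6)) with hs
  set T : ℝ := N ^ (c' + 3) with hT
  have hs0 : 0 < s := by positivity
  have hT0 : 0 < T := by positivity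
  set W : Matrix (Fin n) (Fin l) ℝ := Matrix.of fun a k => u (k.castLE hln) a with hW
  have hWW : Wᵀ * W = 1 := by
    ext i j
    have h := orthonormal_iff_ite.mp u.orthonormal (i.castLE hln) (j.castLE hln)
    simp only [PiLp.inner_apply, RCLike.inner_apply, conj_trivial] at h
    simp only [Matrix.mul_apply, Matrix.transpose_apply, hW, Matrix.of_apply, Matrix.one_apply]
    refine Eq.trans (Finset.sum_congr rfl fun _ _ => mul_comm _ _) (h.trans ?_)
    simp [Fin.ext_iff]
  have hprob : N ^ 2 * (2 * N ^ 2 * s + 1 / T ^ 2) ≤ 1 / N ^ c' := by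
    have h1 : N ^ 2 * (2 * N ^ 2 * s) = 2 * N ^ (-(c' + 2)) := by
      rw [hs, show -(c' + 2) = 2 + 2 + -(c' + 6) by ring, Real.rpow_add hn0, Real.rpow_add hn0,
        Real.rpow_two]
      ring
    have h2 : N ^ 2 * (1 / T ^ 2) = N ^ (-(2 * c' + 4)) := by
      rw [show -(2 * c' + 4) = 2 + -(c' + 3) + -(c' + 3) by ring, Real.rpow_add hn0 (2 + _),
        Real.rpow_add hn0 2, Real.rpow_two, Real.rpow_neg hn0.le, ← hT]
      ring
    have h3 : 2 * N ^ (-(c' + 2)) ≤ N ^ (-(c' + 1)) := by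
      calc 2 * N ^ (-(c' + 2)) ≤ N ^ (1 : ℝ) * N ^ (-(c' + 2)) := by gcongr
        _ = N ^ (-(c' + 1)) := by rw [← Real.rpow_add hn0]; ring_nf
    have h4 : N ^ (-(2 * c' + 4)) ≤ N ^ (-(c' + 1)) :=
      Real.rpow_le_rpow_of_exponent_le hn1 (by linarith)
    have h5 : 2 * N ^ (-(c' + 1)) ≤ N ^ (-c') := by
      calc 2 * N ^ (-(c' + 1)) ≤ N ^ (1 : ℝ) * N ^ (-(c' + 1)) := by gcongr
        _ = N ^ (-c') := by rw [← Real.rpow_add hn0]; ring_nf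
    rw [mul_add, h1, h2, one_div, ← Real.rpow_neg hn0.le]
    linarith
  refine le_trans (measure_mono ?_)
    ((hX.measure_not_wellConditioned_le hl1 hln hWW hs0.le hT0).trans
      (ENNReal.ofReal_le_ofReal hprob))
  intro ω hω
  rw [Set.mem_ofPred_eq] at hω ⊢
  -- From here on everything is deterministic: one good event serves all `Q` and `mu` at once.
  refine fun hgood => hω fun r Q mu hQ hmu => ?_
  obtain ⟨hwell, hentries⟩ := hgood
  have hclose : ∀ i : Fin p, ∃ w ∈ LinearMap.range Q.mulVecLin,
      ‖WithLp.toLp 2 w - u (i.castLE hpn)‖ ≤ (2 / 3) ^ (2 * q + 1) * (N ^ 2 * (T / s)) := by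
    intro i
    rw [hQ.2]
    have hi := hσp (i.castLE hpn) i.2
    -- The ratio `2/3` is `α` over `(3/2) α`: it compares index `l + 1` with `p`, so the small gap
    -- at `p` plays no role in the convergence.
    refine exists_mem_range_krylov_close hA u hu hln hW hs0 hwell hentries q (i.castLE hpl)
      (abs_pos.mp ((hε0.trans hεpos).trans_le hi)) (by norm_num) fun j hj => ?_
    have h1 := hσtail l j hj
    have h2 : sigma A (l + 1) ≤ threshold A l c := le_max_right _ _
    change |lam j| ≤ 2 / 3 * |lam (i.castLE hpn)|
    linarith
  have hδ : N ^ 2 * (2 * ‖A‖ * ((2 / 3) ^ (2 * q + 1) * (N ^ 2 * (T / s)))) < ε := by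
    have hq' := two_thirds_pow_le_rpow hn0 hq
    have hTs : T / s = N ^ ((c' + 3) + (c' + 6)) := by
      rw [hT, hs, Real.rpow_neg hn0.le, div_inv_eq_mul, ← Real.rpow_add hn0]
    have h1 : N ^ 2 * (2 * (2 / 3 * N ^ (-d) * (N ^ 2 * (T / s)))) ≤ 2 / 3 * N ^ (-e) := by
      calc N ^ 2 * (2 * (2 / 3 * N ^ (-d) * (N ^ 2 * (T / s))))
          = 2 * (2 / 3 * (N ^ (2 : ℝ) * N ^ (2 : ℝ) * N ^ ((c' + 3) + (c' + 6)) * N ^ (-d))) := by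
            rw [hTs, Real.rpow_two]; ring
        _ = 2 * (2 / 3 * N ^ (-(e + 1))) := by
            rw [← Real.rpow_add hn0, ← Real.rpow_add hn0, ← Real.rpow_add hn0, hd]
            ring_nf
        _ ≤ N ^ (1 : ℝ) * (2 / 3 * N ^ (-(e + 1))) := by gcongr
        _ = 2 / 3 * (N ^ (1 : ℝ) * N ^ (-(e + 1))) := by ring
        _ = 2 / 3 * N ^ (-e) := by rw [← Real.rpow_add hn0]; ring_nf
    calc N ^ 2 * (2 * ‖A‖ * ((2 / 3) ^ (2 * q + 1) * (N ^ 2 * (T / s))))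
        ≤ N ^ 2 * (2 * ‖A‖ * (2 / 3 * N ^ (-d) * (N ^ 2 * (T / s)))) := by gcongr
      _ = ‖A‖ * (N ^ 2 * (2 * (2 / 3 * N ^ (-d) * (N ^ 2 * (T / s))))) := by ring
      _ ≤ ‖A‖ * (2 / 3 * N ^ (-e)) := by gcongr
      _ = 2 / 3 * ε := by rw [hε]; ring
      _ < ε := by linarith
  obtain ⟨S, hS⟩ := exists_perm_ritz_values hQ.1 hlam.2 hmu u hu hpn hclose hδ
    (fun i j hi hj => by linarith [hσp i hi, hσtail p j hj])
    (fun i hi => hεpos.trans_le (hσp i hi))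
  exact ⟨S, fun i => ⟨(hS i).1.trans hεc₁, (hS i).2⟩⟩
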